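/- Let $K$ be a field, $P=\{p_1,\dots,p_n\}$ a finite poset, and $S=K[x_1,\dots,x_n,y_1,\dots,y_n]$ the standard graded polynomial ring in $2n$ variables. For a subset $\alpha\subseteq P$ put $u_\alpha=\prod_{p_i\in\alpha}x_i\prod_{p_j\notin\alpha}y_j\in S$. The chain ideal $I_C(P)$ is the ideal of $S$ generated by all $u_\alpha$ with $\alpha$ a chain (a totally ordered subset, possibly empty) of $P$, and the antichain ideal $I_A(P)$ is the ideal of $S$ generated by all $u_\beta$ with $\beta$ an antichain (a subset of pairwise incomparable elements, possibly empty) of $P$. Then: 1. $I_C(P)$ and $I_A(P)$ have linear resolutions; that is, for $I=I_C(P)$ and for $I=I_A(P)$ there is an integer $d$ such that, in a minimal graded free resolution $\cdots\to F_1\to F_0\to I\to 0$ over $S$, each $F_i$ is a finite direct sum of copies of $S(-d-i)$. 2. If $P$ is non-empty, then $\operatorname{projdim}_S I_C(P)=\operatorname{rank}P+1$, where $\operatorname{rank}P$ is the largest $r$ for which there is a chain $q_0<q_1<\cdots<q_r$ in $P$. 3. $\operatorname{projdim}_S I_A(P)$ equals the Dilworth number of $P$, i.e. the least number of chains into which $P$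 can be partitioned, and this number is the maximal cardinality of an antichain of $P$. -/

import Mathlib

open scoped Classical in
/-- The squarefree monomial `u_α = (∏_{p ∈ α} x_p) (∏_{p ∉ α} y_p)` attached to a subset `α`
of `P`. The polynomial ring in the `2n` variables `x_p`, `y_p` is `MvPolynomial (P ⊕ P) K`, where
`x_p = X (Sum.inl p)` and `y_p = X (Sum.inr p)`. -/
noncomputable def posetMonomial (K : Type*) [Field K] {P : Type*} [Fintype P] (α : Finset P) :
    MvPolynomial (P ⊕ P) K :=
  (∏ p ∈ α, MvPolynomial.X (Sum.inl p)) * ∏ p ∈ αᶜ, MvPolynomial.X (Sum.inr p)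

/-- The chain ideal `I_C(P)`, generated by the `u_α` with `α` a chain of `P`. -/
noncomputable def chainIdeal (K : Type*) [Field K] (P : Type*) [Fintype P] [PartialOrder P] :
    Ideal (MvPolynomial (P ⊕ P) K) :=
  Ideal.span {f | ∃ α : Finset P, IsChain (· ≤ ·) (α : Set P) ∧ f = posetMonomial K α}

/-- The antichain ideal `I_A(P)`, generated by the `u_β` with `β` an antichain of `P`. -/
noncomputable def antichainIdeal (K : Type*) [Field K] (P : Type*) [Fintype P] [PartialOrder P] :
    Ideal (MvPolynomial (P ⊕ P) K) :=
  Ideal.span {f | ∃ β : Finset P, IsAntichain (· ≤ ·) (β : Set P) ∧ f = posetMonomial K β}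

open scoped Classical in
/-- The Dilworth number of a finite poset: the least number of chains into which it can be
partitioned. -/
noncomputable def dilworthNumber (P : Type*) [Fintype P] [PartialOrder P] : ℕ :=
  sInf {k | ∃ π : Finpartition (Finset.univ : Finset P),
    (∀ c ∈ π.parts, IsChain (· ≤ ·) (c : Set P)) ∧ π.parts.card = k}

/-- The vector `v` is a homogeneous element of degree `t` of the graded free module
`⨁_k S(-a k)`, where `S` has the standard grading: the component `v k` is homogeneous of degree
`t - a k` (and zero if `t < a k`). -/
def IsHomogeneousVector {σ K ι : Type*} [Field K] (a : ι → ℕ) (v : ι → MvPolynomial σ K)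
    (t : ℕ) : Prop :=
  ∀ k, ∀ m ∈ (v k).support, m.degree + a k = t

/-- A graded free resolution `⋯ ⟶ F_2 ⟶ F_1 ⟶ F_0 ⟶ I ⟶ 0` of an ideal `I` of the standard
graded polynomial ring `S = MvPolynomial σ K` by free modules of finite rank
`F_i = ⨁_{j < rank i} S(-shift i j)`, with differentials of degree zero. -/
structure GradedFreeResolution {σ K : Type*} [Field K] (I : Ideal (MvPolynomial σ K)) where
  /-- the rank of `F_i` -/
  rank : ℕ → ℕ
  /-- the degree of the `j`-th basis element of `F_i` -/
  shift : (i : ℕ) → Fin (rank i) → ℕ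
  /-- the augmentation, with values in `I ⊆ S` -/
  aug : (Fin (rank 0) → MvPolynomial σ K) →ₗ[MvPolynomial σ K] MvPolynomial σ K
  /-- the differential `F_{i+1} ⟶ F_i` -/
  d : (i : ℕ) → (Fin (rank (i + 1)) → MvPolynomial σ K) →ₗ[MvPolynomial σ K]
    (Fin (rank i) → MvPolynomial σ K)
  aug_homogeneous : ∀ j, (aug (Pi.single j 1)).IsHomogeneous (shift 0 j)
  d_homogeneous : ∀ i j, IsHomogeneousVector (shift i) (d i (Pi.single j 1)) (shift (i + 1) j)
  range_aug : LinearMap.range aug = I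
  exact_zero : LinearMap.range (d 0) = LinearMap.ker aug
  exact_succ : ∀ i, LinearMap.range (d (i + 1)) = LinearMap.ker (d i)

/-- A graded free resolution is minimal if `d(F_{i+1}) ⊆ 𝔪 F_i` for all `i`, where `𝔪` is the ideal
generated by the variables: no entry of a matrix of a differential has a constant term. -/
def GradedFreeResolution.IsMinimal {σ K : Type*} [Field K] {I : Ideal (MvPolynomial σ K)}
    (F : GradedFreeResolution I) : Prop :=
  ∀ i j k, MvPolynomial.constantCoeff (F.d i (Pi.single j 1) k) = 0

/-- The ideal `I` has a linear resolution: for some `d`, the `i`-th module of a minimal graded free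
resolution of `I` is a direct sum of copies of `S(-d-i)`, for all `i`. -/
def HasLinearResolution {σ K : Type*} [Field K] (I : Ideal (MvPolynomial σ K)) : Prop :=
  ∃ d : ℕ, ∃ F : GradedFreeResolution I, F.IsMinimal ∧ ∀ i j, F.shift i j = d + i

/-- The projective dimension of an ideal `I` of a commutative ring, as a module over the ring. -/
noncomputable def Ideal.projDim {R : Type*} [CommRing R] (I : Ideal R) : WithBot ℕ∞ :=
  CategoryTheory.projectiveDimension (ModuleCat.of R I)

-- Chains, and likewise antichains, form a simplicial complex `Δ` on `P`: subsets of faces are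
-- faces. For any such `Δ` the ideal generated by the `u_F`, `F ∈ Δ`, has an explicit cubical
-- resolution. Its basis in degree `i` consists of the cells `(F, σ)` with `σ ⊆ F ∈ Δ` and `|σ| =
-- i`, thought of as cubes `[F \ σ, F]`. The boundary takes `v` out of `σ` in two ways, to `(F, σ \
-- v)` with coefficient `±y_v` and to `(F \ v, σ \ v)` with coefficient `∓x_v`, in accordance with
-- the relation `y_v u_F = x_v u_{F \ v}`.
--
-- Exactness is an induction that deletes a maximal face `F`. The cells over `F` form the Koszul
-- complex of the `y_v`, `v ∈ F`, which is acyclic in positive degrees. In degree `0`, every other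
-- `u_G` lies in `(y_v : v ∈ F)`, while `u_F` is a nonzerodivisor modulo this ideal, so the
-- coefficient of `u_F` in a relation lies in it. See `exists_koszulD_eq_of_koszulD_eq_zero`,
-- `IsCubicalChain.exists_cubeD_eq` and `IsCubicalChain.exists_cubeD_eq_of_cubeAug_eq_zero`.
--
-- The matrix entries are linear forms, so the resolution is linear and minimal. Its length is the
-- largest cardinality of a face, and by `GradedFreeResolution.IsMinimal.projDim_eq` this is the
-- projective dimension. For chains it is the rank plus one; for antichains it is the Dilworth
-- number, by Dilworth's theorem.
--
-- Chains of the complexes are handled as functions on all (pairs of) subsets with a support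
-- condition; only `cubicalResolution` passes to free modules on the cells.

universe u v w

/-! ### Projective dimension from a minimal free resolution -/

-- Dimension shift along `0 → ker f → M → range f → 0`. The kernel enters as a submodule `L` with an
-- equation, so that the range of the next differential can be inserted directly.
open CategoryTheory in
theorem hasProjectiveDimensionLE_range_succ_iff {R : Type u} [CommRing R] {M N : Type u}
    [AddCommGroup M] [Module R M] [AddCommGroup N] [Module R N] [Module.Projective R M]
    (f : M →ₗ[R] N) {L : Submodule R M} (hL : L = LinearMap.ker f) (n : ℕ) :
    HasProjectiveDimensionLE (ModuleCat.of R (LinearMap.range f)) (n + 1) ↔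
      HasProjectiveDimensionLE (ModuleCat.of R L) n := by
  subst hL
  have hs : Function.Surjective f.rangeRestrict := f.surjective_rangeRestrict
  have hP : Projective (ModuleCat.of R M) := (IsProjective.iff_projective M).1 inferInstance
  have key := (LinearMap.shortExact_shortComplexKer hs).hasProjectiveDimensionLT_X₃_iff n hP
  have hk : LinearMap.ker f.rangeRestrict = LinearMap.ker f := f.ker_rangeRestrict
  rw [← hk]
  exact key

-- The dimension shift iterated: the range of `F.d i` is the `(i + 1)`-st syzygy module of `I`.
open CategoryTheory in
theorem GradedFreeResolution.hasProjectiveDimensionLE_iff {σ : Type v} {K : Type w} [Field K]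
    {I : Ideal (MvPolynomial σ K)} (F : GradedFreeResolution I) (i n : ℕ) :
    HasProjectiveDimensionLE (ModuleCat.of (MvPolynomial σ K) I) (n + i + 1) ↔
      HasProjectiveDimensionLE (ModuleCat.of (MvPolynomial σ K) (LinearMap.range (F.d i))) n := by
  induction i generalizing n with
  | zero =>
    have h := hasProjectiveDimensionLE_range_succ_iff F.aug F.exact_zero n
    rw [← h]
    constructor
    · intro _
      exact ModuleCat.hasProjectiveDimensionLE_of_linearEquiv
        (M := ModuleCat.of (MvPolynomial σ K) I) (LinearEquiv.ofEq _ _ F.range_aug.symm) _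
    · intro _
      exact ModuleCat.hasProjectiveDimensionLE_of_linearEquiv
        (M := ModuleCat.of (MvPolynomial σ K) (LinearMap.range F.aug)) (LinearEquiv.ofEq _ _ F.range_aug) _
  | succ i ih =>
    rw [← hasProjectiveDimensionLE_range_succ_iff (F.d i) (F.exact_succ i) n, ← ih,
      show n + (i + 1) + 1 = n + 1 + i + 1 by omega]

/-- A linear map of free modules all of whose matrix entries have no constant term, and whose
source is nonzero, has no retraction. -/
theorem not_exists_retraction_of_constantCoeff_eq_zero {σ K : Type*} [Field K] {m n : ℕ}
    (hm : m ≠ 0) (f : (Fin m → MvPolynomial σ K) →ₗ[MvPolynomial σ K] (Fin n → MvPolynomial σ K))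
    (hf : ∀ j k, MvPolynomial.constantCoeff (f (Pi.single j 1) k) = 0)
    (r : (Fin n → MvPolynomial σ K) →ₗ[MvPolynomial σ K] (Fin m → MvPolynomial σ K)) :
    ¬ ∀ v, r (f v) = v := by
  intro h
  let j : Fin m := ⟨0, Nat.pos_of_ne_zero hm⟩
  have h1 := congrFun (h (Pi.single j 1)) j
  have h2 := congrArg MvPolynomial.constantCoeff h1
  -- The constant term of the `j`-th coordinate of `r (f e_j)` is a sum of products with the
  -- vanishing constant terms of `f e_j`, but that coordinate equals `1`.
  rw [LinearMap.pi_apply_eq_sum_univ r, Finset.sum_apply, map_sum] at h2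
  simp [hf] at h2

/-- If `0 → L → M → N` is exact and the range of `M → N` is projective, then `L → M` has a
retraction. -/
theorem exists_retraction_of_projective_range {R L M N : Type*} [CommRing R]
    [AddCommGroup L] [Module R L] [AddCommGroup M] [Module R M] [AddCommGroup N] [Module R N]
    (f : L →ₗ[R] M) (hf : Function.Injective f) (g : M →ₗ[R] N)
    (hfg : LinearMap.range f = LinearMap.ker g) [Module.Projective R (LinearMap.range g)] :
    ∃ r : M →ₗ[R] L, ∀ v, r (f v) = v := by
  obtain ⟨s, hs⟩ := Module.projective_lifting_property g.rangeRestrict LinearMap.id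
    g.surjective_rangeRestrict
  have hs' : ∀ x, g.rangeRestrict (s x) = x := fun x => LinearMap.congr_fun hs x
  -- The projection of `M` onto `ker g` along the section `s`.
  let p : M →ₗ[R] M := LinearMap.id - s ∘ₗ g.rangeRestrict
  have hp : ∀ x, p x ∈ LinearMap.range f := by
    intro x
    rw [hfg, ← LinearMap.ker_rangeRestrict, LinearMap.mem_ker]
    simp [p, hs']
  let e := LinearEquiv.ofInjective f hf
  refine ⟨e.symm.toLinearMap ∘ₗ p.codRestrict _ hp, fun v => ?_⟩
  have : g.rangeRestrict (f v) = 0 := by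
    rw [← LinearMap.mem_ker, LinearMap.ker_rangeRestrict, ← hfg]
    exact ⟨v, rfl⟩
  apply e.injective
  ext1
  simp [e, p, this]

open CategoryTheory in
/-- The projective dimension is the length of a minimal graded free resolution. -/
theorem GradedFreeResolution.IsMinimal.projDim_eq {σ K : Type*} [Field K]
    {I : Ideal (MvPolynomial σ K)} {F : GradedFreeResolution I} (hF : F.IsMinimal) {D : ℕ}
    (hD : F.rank D ≠ 0) (hD' : F.rank (D + 1) = 0) (hI : I ≠ ⊥) : I.projDim = D := by
  have : IsEmpty (Fin (F.rank (D + 1))) := by rw [hD']; infer_instance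
  have hr : LinearMap.range (F.d D) = ⊥ := by
    rw [LinearMap.range_eq_bot]
    exact Subsingleton.elim _ _
  unfold Ideal.projDim
  obtain _ | D := D
  · have hinj : Function.Injective F.aug := by
      rw [← LinearMap.ker_eq_bot, ← F.exact_zero, hr]
    have e := (LinearEquiv.ofInjective _ hinj).trans (LinearEquiv.ofEq _ _ F.range_aug)
    have : Module.Projective (MvPolynomial σ K) I := Module.Projective.of_equiv e
    -- The zero module has projective dimension `⊥`, so dimension `0` also requires `I ≠ ⊥`.
    rw [Nat.cast_zero, projectiveDimension_eq_zero_iff, ← IsProjective.iff_projective]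
    refine ⟨this, fun h => hI ?_⟩
    rw [ModuleCat.isZero_iff_subsingleton] at h
    exact (Submodule.subsingleton_iff_eq_bot).1 h
  · have hinj : Function.Injective (F.d D) := by
      rw [← LinearMap.ker_eq_bot, ← F.exact_succ, hr]
    apply le_antisymm
    · rw [projectiveDimension_le_iff]
      have h := (F.hasProjectiveDimensionLE_iff D 0)
      rw [zero_add] at h
      rw [h, ← projective_iff_hasProjectiveDimensionLE_zero, ← IsProjective.iff_projective]
      exact Module.Projective.of_equiv (LinearEquiv.ofInjective _ hinj)
    · rw [projectiveDimension_ge_iff]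
      intro h
      -- If the dimension were smaller, the range of the map leaving `F_D` (the augmentation when `D
      -- = 0`) would be projective, and the last nonzero differential would split.
      have hret : ∃ r : (Fin (F.rank D) → MvPolynomial σ K) →ₗ[MvPolynomial σ K]
          (Fin (F.rank (D + 1)) → MvPolynomial σ K), ∀ v, r (F.d D v) = v := by
        obtain _ | D := D
        · have : Module.Projective (MvPolynomial σ K) I := by
            rw [IsProjective.iff_projective]
            exact projective_iff_hasProjectiveDimensionLT_one.2 h
          have : Module.Projective (MvPolynomial σ K) (LinearMap.range F.aug) :=
            Module.Projective.of_equiv (LinearEquiv.ofEq _ _ F.range_aug.symm)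
          exact exists_retraction_of_projective_range _ hinj F.aug F.exact_zero
        · have h' := F.hasProjectiveDimensionLE_iff D 0
          rw [zero_add] at h'
          have h'' := h'.1 h
          rw [← projective_iff_hasProjectiveDimensionLE_zero, ← IsProjective.iff_projective] at h''
          exact exists_retraction_of_projective_range _ hinj (F.d D) (F.exact_succ D)
      obtain ⟨r, hr⟩ := hret
      exact not_exists_retraction_of_constantCoeff_eq_zero hD (F.d D) (hF D) r hr

/-! ### Signs of the boundary maps -/

section Sign

variable {V S : Type*} [CommRing S] (idx : V → ℕ)

/-- The sign `(-1)^k`, where `k` is the number of elements of `τ` that precede `v`. -/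
def insertSign (S : Type*) [CommRing S] (v : V) (τ : Finset V) : S :=
  (-1) ^ (τ.filter fun w => idx w < idx v).card

theorem insertSign_insert_of_lt [DecidableEq V] {v w : V} {τ : Finset V} (hw : w ∉ τ)
    (h : idx w < idx v) : insertSign idx S v (insert w τ) = -insertSign idx S v τ := by
  rw [insertSign, insertSign, Finset.filter_insert, if_pos h, Finset.card_insert_of_notMem, pow_succ]
  · ring
  · simp [hw]

theorem insertSign_insert_of_not_lt [DecidableEq V] {v w : V} {τ : Finset V}
    (h : ¬ idx w < idx v) : insertSign idx S v (insert w τ) = insertSign idx S v τ := by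
  rw [insertSign, insertSign, Finset.filter_insert, if_neg h]

/-- Exactly one of `v`, `w` precedes the other, so exactly one of the two signs changes when the
other element is inserted. This is what makes the boundary square to zero. -/
theorem insertSign_antisymm [DecidableEq V] (hidx : Function.Injective idx) {v w : V}
    {τ : Finset V} (hv : v ∉ τ) (hw : w ∉ τ) (hvw : v ≠ w) :
    insertSign idx S v τ * insertSign idx S w (insert v τ) =
      -(insertSign idx S w τ * insertSign idx S v (insert w τ)) := by
  rcases lt_or_gt_of_ne (hidx.ne hvw) with h | h
  · rw [insertSign_insert_of_lt idx hv h, insertSign_insert_of_not_lt idx h.not_gt]; ring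
  · rw [insertSign_insert_of_not_lt idx h.not_gt, insertSign_insert_of_lt idx hw h]; ring

theorem insertSign_of_forall_lt {v : V} {τ : Finset V} (h : ∀ w ∈ τ, idx w < idx v) :
    insertSign idx S v τ = (-1) ^ τ.card := by
  rw [insertSign, Finset.filter_true_of_mem h]

@[simp]
theorem insertSign_empty (v : V) : insertSign idx S v ∅ = 1 := by simp [insertSign]

end Sign

/-! ### Exactness of the Koszul complex -/

section Koszul

variable {V S : Type*} [CommRing S] [DecidableEq V] (idx : V → ℕ) (y : V → S)

/-- The differential of the Koszul complex of the elements `y v`, `v ∈ F`, a chain being written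
as the function of its coefficients at the subsets of `F`. -/
def koszulD (F : Finset V) : (Finset V → S) →ₗ[S] (Finset V → S) where
  toFun c τ := ∑ v ∈ F \ τ, insertSign idx S v τ * (y v * c (insert v τ))
  map_add' b c := by
    ext τ
    simp only [Pi.add_apply, ← Finset.sum_add_distrib]
    exact Finset.sum_congr rfl fun v _ => by ring
  map_smul' a c := by
    ext τ
    simp only [Pi.smul_apply, smul_eq_mul, RingHom.id_apply, Finset.mul_sum]
    exact Finset.sum_congr rfl fun v _ => by ring

theorem koszulD_apply (F : Finset V) (c : Finset V → S) (τ : Finset V) :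
    koszulD idx y F c τ = ∑ v ∈ F \ τ, insertSign idx S v τ * (y v * c (insert v τ)) := rfl

theorem koszulD_congr {F : Finset V} {b c : Finset V → S} {τ : Finset V}
    (h : ∀ v ∈ F, v ∉ τ → b (insert v τ) = c (insert v τ)) :
    koszulD idx y F b τ = koszulD idx y F c τ := by
  rw [koszulD_apply, koszulD_apply]
  refine Finset.sum_congr rfl fun v hv => ?_
  rw [Finset.mem_sdiff] at hv
  rw [h v hv.1 hv.2]

theorem koszulD_insert_of_notMem {F : Finset V} {w : V} (hw : w ∉ F) (c : Finset V → S)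
    {τ : Finset V} (hτ : w ∉ τ) :
    koszulD idx y (insert w F) c τ =
      insertSign idx S w τ * (y w * c (insert w τ)) + koszulD idx y F c τ := by
  rw [koszulD_apply, Finset.insert_sdiff_of_notMem _ hτ, Finset.sum_insert (by simp [hw]),
    koszulD_apply]

theorem koszulD_insert_insert {F : Finset V} {w : V} (hw : w ∉ F)
    (hlt : ∀ v ∈ F, idx v < idx w) (c : Finset V → S) {τ : Finset V} :
    koszulD idx y (insert w F) c (insert w τ) =
      koszulD idx y F (fun σ => c (insert w σ)) τ := by
  rw [koszulD_apply, koszulD_apply]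
  have : insert w F \ insert w τ = F \ τ := by
    ext v
    simp only [Finset.mem_sdiff, Finset.mem_insert]
    constructor
    · tauto
    · rintro ⟨h1, h2⟩
      have : v ≠ w := fun h => hw (h ▸ h1)
      tauto
  rw [this]
  refine Finset.sum_congr rfl fun v hv => ?_
  rw [insertSign_insert_of_not_lt idx (hlt v (Finset.mem_sdiff.1 hv).1).not_gt,
    Finset.insert_comm]

/-- The degree `0` end of the Koszul complex: the coefficients of `c ∅` in terms of the `y v` are
placed at the singletons. -/
theorem exists_koszulD_eq_of_mem_span {F : Finset V} {c : Finset V → S}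
    (hc : ∀ τ, c τ ≠ 0 → τ = ∅) (hspan : c ∅ ∈ Ideal.span (y '' (F : Set V))) :
    ∃ b : Finset V → S, (∀ τ, b τ ≠ 0 → τ ⊆ F ∧ τ.card = 1) ∧ koszulD idx y F b = c := by
  obtain ⟨a, ha⟩ : ∃ a : V → S, ∑ v ∈ F, a v • y v = c ∅ := by
    obtain ⟨a, ha⟩ := (Submodule.mem_span_image_finset_iff_exists_fun S).1 hspan
    refine ⟨fun v => if h : v ∈ F then a ⟨v, h⟩ else 0, ?_⟩
    rw [← ha, ← Finset.sum_coe_sort]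
    simp
  refine ⟨fun τ => ∑ v ∈ F, if τ = {v} then a v else 0, fun τ hτ => ?_, ?_⟩
  · obtain ⟨v, hv, h⟩ := Finset.exists_ne_zero_of_sum_ne_zero hτ
    have : τ = {v} := by by_contra h'; simp [h'] at h
    subst this
    simpa using hv
  · ext τ
    rw [koszulD_apply]
    by_cases hτ : τ = ∅
    · subst hτ
      rw [Finset.sdiff_empty, ← ha]
      refine Finset.sum_congr rfl fun v hv => ?_
      have : (∑ x ∈ F, if insert v ∅ = ({x} : Finset V) then a x else 0) = a v := by
        rw [Finset.sum_eq_single_of_mem v hv]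
        · simp
        · intro w _ hne
          simp [Ne.symm hne]
      rw [this, insertSign_empty, smul_eq_mul]; ring
    · have : c τ = 0 := by_contra fun h => hτ (hc τ h)
      rw [this]
      refine Finset.sum_eq_zero fun v hv => ?_
      rw [Finset.sum_eq_zero, mul_zero, mul_zero]
      intro w _
      rw [if_neg]
      intro h
      have h1 := congrArg Finset.card h
      rw [Finset.card_insert_of_notMem (Finset.mem_sdiff.1 hv).2, Finset.card_singleton] at h1
      exact hτ (Finset.card_eq_zero.1 (by omega))

theorem koszulD_empty_mem_span (F : Finset V) (c : Finset V → S) :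
    koszulD idx y F c ∅ ∈ Ideal.span (y '' (F : Set V)) := by
  rw [koszulD_apply]
  refine Ideal.sum_mem _ fun v hv => Ideal.mul_mem_left _ _ (Ideal.mul_mem_right _ _ ?_)
  exact Ideal.subset_span ⟨v, by simpa using hv, rfl⟩

/-- The Koszul complex of a sequence that is regular in every order is exact in positive degrees. -/
theorem exists_koszulD_eq_of_koszulD_eq_zero (hidx : Function.Injective idx)
    (hy : ∀ (G : Finset V) (w : V), w ∉ G → ∀ a, y w * a ∈ Ideal.span (y '' (G : Set V)) →
      a ∈ Ideal.span (y '' (G : Set V)))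
    (F : Finset V) (i : ℕ) (c : Finset V → S) (hc : ∀ τ, c τ ≠ 0 → τ ⊆ F ∧ τ.card = i + 1)
    (hc0 : koszulD idx y F c = 0) :
    ∃ b : Finset V → S, (∀ τ, b τ ≠ 0 → τ ⊆ F ∧ τ.card = i + 2) ∧ koszulD idx y F b = c := by
  induction F using Finset.induction_on_max_value idx generalizing i c with
  | empty =>
    refine ⟨0, by simp, ?_⟩
    rw [map_zero]
    ext τ
    by_contra h
    obtain ⟨h1, h2⟩ := hc τ (Ne.symm h)
    simp [Finset.subset_empty.1 h1] at h2
  | insert w F hw hmax ih =>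
    have hlt : ∀ v ∈ F, idx v < idx w := fun v hv =>
      lt_of_le_of_ne (hmax v hv) (hidx.ne fun h => hw (h ▸ hv))
    have sub_of : ∀ {τ : Finset V}, w ∉ τ → τ ⊆ insert w F → τ ⊆ F := fun hτ h =>
      (Finset.subset_insert_iff_of_notMem hτ).1 h
    -- Split `c` into the part `c₀` away from `w` and the part `c₁` containing `w`, with `w`
    -- removed; both live on `F`.
    set c₀ : Finset V → S := fun τ => if w ∈ τ then 0 else c τ
    set c₁ : Finset V → S := fun τ => if w ∈ τ then 0 else c (insert w τ)
    have c₁supp : ∀ τ, c₁ τ ≠ 0 → τ ⊆ F ∧ τ.card = i := by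
      intro τ h
      by_cases hτ : w ∈ τ
      · simp [c₁, hτ] at h
      · simp only [c₁, hτ, if_false] at h
        obtain ⟨h1, h2⟩ := hc _ h
        rw [Finset.card_insert_of_notMem hτ] at h2
        exact ⟨sub_of hτ ((Finset.subset_insert w τ).trans h1), by omega⟩
    have hw' : ∀ {τ : Finset V}, w ∉ τ → ∀ v ∈ F, w ∉ insert v τ := by
      intro τ hτ v hv h
      rcases Finset.mem_insert.1 h with rfl | h
      · exact hw hv
      · exact hτ h
    have hrel : ∀ τ, w ∉ τ → koszulD idx y F c₀ τ = -(insertSign idx S w τ * (y w * c₁ τ)) := by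
      intro τ hτ
      have h1 := congrFun hc0 τ
      rw [koszulD_insert_of_notMem idx y hw c hτ] at h1
      have h2 : koszulD idx y F c₀ τ = koszulD idx y F c τ :=
        koszulD_congr idx y fun v hv _ => by simp only [c₀, hw' hτ v hv, if_false]
      rw [h2, show c₁ τ = c (insert w τ) by simp [c₁, hτ]]
      exact eq_neg_of_add_eq_zero_right h1
    obtain ⟨b₁, hb₁, hb₁'⟩ : ∃ b₁ : Finset V → S,
        (∀ τ, b₁ τ ≠ 0 → τ ⊆ F ∧ τ.card = i + 1) ∧ koszulD idx y F b₁ = c₁ := by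
      -- The part `c₁` has degree one less. In degree `0` the induction hypothesis says nothing, and
      -- regularity of `y w` modulo the other elements replaces it.
      obtain _ | i := i
      · refine exists_koszulD_eq_of_mem_span idx y
          (fun τ h => Finset.card_eq_zero.1 (c₁supp τ h).2) (hy F w hw _ ?_)
        have h := hrel ∅ (by simp)
        rw [insertSign_empty, one_mul] at h
        rw [← neg_neg (y w * c₁ ∅), ← h]
        exact neg_mem (koszulD_empty_mem_span idx y F c₀)
      · refine ih i c₁ c₁supp ?_
        ext τ
        by_cases hτ : w ∈ τ
        · rw [koszulD_apply, Pi.zero_apply]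
          exact Finset.sum_eq_zero fun v _ => by simp [c₁, hτ]
        · have h1 := congrFun hc0 (insert w τ)
          rw [koszulD_insert_insert idx y hw hlt] at h1
          refine Eq.trans ?_ h1
          exact koszulD_congr idx y fun v hv _ => by simp only [c₁, hw' hτ v hv, if_false]
    -- Since `w` comes last, `s` is the sign of inserting `w` into a set of `i + 1` elements, such
    -- as those supporting `b₁`. Subtracting `s y_w b₁` turns `c₀` into a cycle on `F`.
    set s : S := (-1) ^ (i + 1) with hs
    obtain ⟨b₀, hb₀, hb₀'⟩ := ih i (c₀ - (s * y w) • b₁) (by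
        intro τ h
        by_cases h1 : b₁ τ = 0
        · have h2 : c₀ τ ≠ 0 := by simpa [h1] using h
          by_cases hτ : w ∈ τ
          · simp [c₀, hτ] at h2
          · simp only [c₀, hτ, if_false] at h2
            exact ⟨sub_of hτ (hc τ h2).1, (hc τ h2).2⟩
        · exact hb₁ τ h1) (by
        rw [map_sub, map_smul, hb₁']
        ext τ
        by_cases hτ : w ∈ τ
        · have h1 : koszulD idx y F c₀ τ = 0 := by
            rw [koszulD_apply]
            exact Finset.sum_eq_zero fun v _ => by simp [c₀, hτ]
          simp [h1, c₁, hτ]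
        · rw [Pi.sub_apply, hrel τ hτ, Pi.smul_apply, smul_eq_mul, Pi.zero_apply]
          by_cases h1 : c₁ τ = 0
          · simp [h1]
          · obtain ⟨h2, h3⟩ := c₁supp τ h1
            rw [insertSign_of_forall_lt idx fun v hv => hlt v (h2 hv), h3, hs]
            ring)
    refine ⟨fun σ => if w ∈ σ then b₁ (σ.erase w) else b₀ σ, fun σ hσ => ?_, ?_⟩
    · by_cases h : w ∈ σ
      · simp only [h, if_true] at hσ
        obtain ⟨h1, h2⟩ := hb₁ _ hσ
        rw [Finset.card_erase_of_mem h] at h2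
        have := Finset.card_pos.2 ⟨w, h⟩
        exact ⟨by rwa [Finset.subset_insert_iff], by omega⟩
      · simp only [h, if_false] at hσ
        obtain ⟨h1, h2⟩ := hb₀ _ hσ
        exact ⟨h1.trans (Finset.subset_insert _ _), h2⟩
    · ext τ
      by_cases hτ : w ∈ τ
      · rw [← Finset.insert_erase hτ, koszulD_insert_insert idx y hw hlt]
        have h1 : koszulD idx y F (fun σ => if w ∈ insert w σ then b₁ ((insert w σ).erase w)
            else b₀ (insert w σ)) (τ.erase w) = koszulD idx y F b₁ (τ.erase w) := by
          refine koszulD_congr idx y fun v hv _ => ?_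
          rw [if_pos (Finset.mem_insert_self _ _),
            Finset.erase_insert (hw' (Finset.notMem_erase w τ) v hv)]
        rw [h1, hb₁']
        simp [c₁]
      · rw [koszulD_insert_of_notMem idx y hw _ hτ]
        have h1 : koszulD idx y F (fun σ => if w ∈ σ then b₁ (σ.erase w) else b₀ σ) τ =
            koszulD idx y F b₀ τ :=
          koszulD_congr idx y fun v hv _ => by simp only [hw' hτ v hv, if_false]
        rw [h1, hb₀']
        simp only [Finset.mem_insert_self, if_true, Finset.erase_insert hτ, Pi.sub_apply,
          Pi.smul_apply, smul_eq_mul, c₀, hτ, if_false]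
        by_cases h2 : b₁ τ = 0
        · simp [h2]
        · obtain ⟨h3, h4⟩ := hb₁ τ h2
          rw [insertSign_of_forall_lt idx fun v hv => hlt v (h3 hv), h4, hs]
          ring

end Koszul

/-! ### Dilworth's theorem, by Galvin's induction on a maximal element -/

/-- Dilworth's theorem, as a colouring with chains as colour classes. -/
theorem exists_chain_coloring {P : Type*} [PartialOrder P] (s : Finset P) (k : ℕ)
    (hk : ∀ β ⊆ s, IsAntichain (· ≤ ·) (β : Set P) → β.card ≤ k) :
    ∃ f : P → ℕ, (∀ x ∈ s, f x < k) ∧ ∀ x ∈ s, ∀ y ∈ s, f x = f y → x ≤ y ∨ y ≤ x := by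
  classical
  induction hn : s.card using Nat.strong_induction_on generalizing s k with
  | _ n ih =>
  subst hn
  obtain rfl | hs := s.eq_empty_or_nonempty
  · exact ⟨fun _ => 0, by simp⟩
  obtain ⟨a, has, hmax⟩ := s.exists_maximal hs
  have hmax' : ∀ x ∈ s, a ≤ x → x = a := fun x hx h => le_antisymm (hmax hx h) h
  have hkpos : 0 < k := hk {a} (by simpa using has) (by simp)
  -- a chain whose removal lowers the width gives a new colour
  have extend : ∀ C ⊆ s, C.Nonempty → (∀ x ∈ C, ∀ y ∈ C, x ≤ y ∨ y ≤ x) →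
      (∀ β ⊆ s \ C, IsAntichain (· ≤ ·) (β : Set P) → β.card ≤ k - 1) →
      ∃ f : P → ℕ, (∀ x ∈ s, f x < k) ∧ ∀ x ∈ s, ∀ y ∈ s, f x = f y → x ≤ y ∨ y ≤ x := by
    intro C hC hne hchain hβ
    obtain ⟨f, hf, hf'⟩ := ih (s \ C).card
      (Finset.card_lt_card (Finset.sdiff_ssubset hC hne)) (s \ C) (k - 1) hβ rfl
    refine ⟨fun x => if x ∈ C then k - 1 else f x, fun x hx => ?_, fun x hx y hy => ?_⟩
    · by_cases h : x ∈ C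
      · simp only [h, if_true]; omega
      · have := hf x (by simp [hx, h])
        simp only [h, if_false]; omega
    · by_cases h : x ∈ C <;> by_cases h' : y ∈ C <;> simp only [h, h', if_true, if_false]
      · exact fun _ => hchain x h y h'
      · have := hf y (by simp [hy, h'])
        intro; omega
      · have := hf x (by simp [hx, h])
        intro; omega
      · exact hf' x (by simp [hx, h]) y (by simp [hy, h'])
  -- If removing `a` already lowers the bound on antichains, `{a}` can be a colour class by itself.
  by_cases hw : ∃ β ⊆ s.erase a, IsAntichain (· ≤ ·) (β : Set P) ∧ β.card = k
  swap
  · refine extend {a} (by simpa using has) (by simp) (by simp) fun β hβ hβ' => ?_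
    rw [Finset.sdiff_singleton_eq_erase] at hβ
    have h1 := hk β (hβ.trans (Finset.erase_subset _ _)) hβ'
    have h2 : β.card ≠ k := fun h => hw ⟨β, hβ, hβ', h⟩
    omega
  obtain ⟨A₀, hA₀, hA₀', hA₀k⟩ := hw
  obtain ⟨f, hf, hf'⟩ := ih _ (Finset.card_erase_lt_of_mem has) (s.erase a) k
    (fun β hβ => hk β (hβ.trans (Finset.erase_subset _ _))) rfl
  -- Colours are distinct on an antichain, so one with `k` elements uses all `k` colours.
  have meets : ∀ A ⊆ s.erase a, IsAntichain (· ≤ ·) (A : Set P) → A.card = k →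
      ∀ i < k, ∃ y ∈ A, f y = i := by
    intro A hA hA' hAk i hi
    have hinj : Set.InjOn f A := by
      intro x hx y hy hxy
      by_contra hne
      rcases hf' x (hA hx) y (hA hy) hxy with h | h
      · exact hA' hx hy hne h
      · exact hA' hy hx (Ne.symm hne) h
    have him : A.image f = Finset.range k := by
      apply Finset.eq_of_subset_of_card_le
      · intro j hj
        obtain ⟨x, hx, rfl⟩ := Finset.mem_image.1 hj
        exact Finset.mem_range.2 (hf x (hA hx))
      · rw [Finset.card_image_of_injOn hinj, hAk, Finset.card_range]
    have : i ∈ A.image f := by rw [him]; exact Finset.mem_range.2 hi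
    simpa using this
  -- The elements of colour `i` that lie on some antichain of size `k`; `x i` will be the largest of
  -- them.
  let T : ℕ → Finset P := fun i => (s.erase a).filter fun z => f z = i ∧
    ∃ A ⊆ s.erase a, IsAntichain (· ≤ ·) (A : Set P) ∧ A.card = k ∧ z ∈ A
  have hT : ∀ i : Fin k, ∃ x, x ∈ T i ∧ ∀ z ∈ T i, z ≤ x := by
    intro i
    obtain ⟨y, hy, hyi⟩ := meets A₀ hA₀ hA₀' hA₀k i i.2
    have hne : (T i).Nonempty :=
      ⟨y, Finset.mem_filter.2 ⟨hA₀ hy, hyi, A₀, hA₀, hA₀', hA₀k, hy⟩⟩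
    obtain ⟨x, hx, hxmax⟩ := (T i).exists_maximal hne
    refine ⟨x, hx, fun z hz => ?_⟩
    have h1 := Finset.mem_filter.1 hx
    have h2 := Finset.mem_filter.1 hz
    rcases hf' x h1.1 z h2.1 (h1.2.1.trans h2.2.1.symm) with h | h
    · exact hxmax hz h
    · exact h
  choose x hxT hxmax using hT
  have hfx : ∀ i, f (x i) = i := fun i => (Finset.mem_filter.1 (hxT i)).2.1
  have hxs : ∀ i, x i ∈ s.erase a := fun i => (Finset.mem_filter.1 (hxT i)).1
  have hxinj : Function.Injective x := fun i j h => by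
    have := congrArg f h
    rw [hfx, hfx] at this
    exact Fin.ext this
  -- A `k`-antichain `A` through `x i` has an element `y` of colour `j`, and `y ≤ x j ≤ x i` forces
  -- `y = x i`. So the `x i` form an antichain.
  have hanti : ∀ i j, x j ≤ x i → i = j := by
    intro i j hij
    obtain ⟨-, -, A, hA, hA', hAk, hiA⟩ := Finset.mem_filter.1 (hxT i)
    obtain ⟨y, hy, hyj⟩ := meets A hA hA' hAk j j.2
    have hyx : y ≤ x j := hxmax j y (Finset.mem_filter.2 ⟨hA hy, hyj, A, hA, hA', hAk, hy⟩)
    have : y = x i := by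
      by_contra hne
      exact hA' hy hiA hne (hyx.trans hij)
    apply Fin.ext
    rw [← hfx i, ← this, hyj]
  -- If no `x i` is below the maximal element `a`, then `a` and the `x i` form an antichain of size
  -- `k + 1`.
  by_cases hle : ∃ i, x i ≤ a
  swap
  · exfalso
    have hcard := hk (insert a (Finset.univ.image x)) ?_ ?_
    · rw [Finset.card_insert_of_notMem, Finset.card_image_of_injective _ hxinj] at hcard
      · simp at hcard
      · intro h
        obtain ⟨i, -, hi⟩ := Finset.mem_image.1 h
        exact hle ⟨i, hi.le⟩
    · intro z hz
      rcases Finset.mem_insert.1 hz with rfl | hz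
      · exact has
      · obtain ⟨i, -, rfl⟩ := Finset.mem_image.1 hz
        exact Finset.mem_of_mem_erase (hxs i)
    · intro u hu w hw hne huw
      simp only [Finset.coe_insert, Finset.coe_image, Finset.coe_univ, Set.image_univ,
        Set.mem_insert_iff, Set.mem_range] at hu hw
      rcases hu with rfl | ⟨i, rfl⟩ <;> rcases hw with rfl | ⟨j, rfl⟩
      · exact hne rfl
      · exact hne (hmax' _ (Finset.mem_of_mem_erase (hxs j)) huw).symm
      · exact hle ⟨i, huw⟩
      · exact hne (by rw [hanti j i huw])
  obtain ⟨i, hi⟩ := hle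
  -- Remove `a` with everything of colour `i` below `x i`. A remaining `k`-antichain would contain
  -- an element of colour `i`, which lies in `T i` and so below `x i`.
  refine extend (insert a ((s.erase a).filter fun z => f z = i ∧ z ≤ x i)) ?_ (by simp) ?_ ?_
  · intro z hz
    rcases Finset.mem_insert.1 hz with rfl | hz
    · exact has
    · exact Finset.mem_of_mem_erase (Finset.mem_filter.1 hz).1
  · intro u hu w hw
    simp only [Finset.mem_insert, Finset.mem_filter] at hu hw
    rcases hu with rfl | ⟨hu, hui, hux⟩ <;> rcases hw with rfl | ⟨hw, hwi, hwx⟩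
    · exact Or.inl le_rfl
    · exact Or.inr (hwx.trans hi)
    · exact Or.inl (hux.trans hi)
    · exact hf' u hu w hw (hui.trans hwi.symm)
  · intro β hβ hβ'
    have hβs : β ⊆ s := hβ.trans Finset.sdiff_subset
    have hβe : β ⊆ s.erase a := fun z hz => Finset.mem_erase.2
      ⟨fun h => by have := hβ hz; simp [h] at this, hβs hz⟩
    have h1 := hk β hβs hβ'
    have h2 : β.card ≠ k := by
      intro h
      obtain ⟨y, hy, hyi⟩ := meets β hβe hβ' h i i.2
      have h3 : y ≤ x i := hxmax i y (Finset.mem_filter.2 ⟨hβe hy, hyi, β, hβe, hβ', h, hy⟩)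
      have h4 := hβ hy
      rw [Finset.mem_sdiff, Finset.mem_insert, Finset.mem_filter] at h4
      exact h4.2 (Or.inr ⟨hβe hy, hyi, h3⟩)
    omega

/-- Dilworth's theorem. -/
theorem isGreatest_dilworthNumber (P : Type*) [Fintype P] [PartialOrder P] :
    IsGreatest {k : ℕ | ∃ β : Finset P, IsAntichain (· ≤ ·) (β : Set P) ∧ β.card = k}
      (dilworthNumber P) := by
  classical
  have hbdd : BddAbove {k : ℕ | ∃ β : Finset P, IsAntichain (· ≤ ·) (β : Set P) ∧ β.card = k} := by
    refine ⟨Fintype.card P, ?_⟩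
    rintro _ ⟨β, -, rfl⟩
    exact β.card_le_univ
  obtain ⟨β, hβ, hβk⟩ := Nat.sSup_mem (s := {k : ℕ | ∃ β : Finset P,
    IsAntichain (· ≤ ·) (β : Set P) ∧ β.card = k}) ⟨0, ∅, by simp⟩ hbdd
  have hmax : ∀ γ : Finset P, IsAntichain (· ≤ ·) (γ : Set P) → γ.card ≤ β.card := by
    intro γ hγ
    rw [hβk]
    exact le_csSup hbdd ⟨γ, hγ, rfl⟩
  -- The easy inequality: a chain contains at most one element of an antichain.
  have hlow : ∀ γ : Finset P, IsAntichain (· ≤ ·) (γ : Set P) →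
      ∀ π : Finpartition (Finset.univ : Finset P),
      (∀ c ∈ π.parts, IsChain (· ≤ ·) (c : Set P)) → γ.card ≤ π.parts.card := by
    intro γ hγ π hπ
    apply Finset.card_le_card_of_injOn π.part
    · intro x _
      exact π.part_mem.2 (Finset.mem_univ x)
    · intro x hx y hy hxy
      by_contra hne
      have h1 : x ∈ π.part x := π.mem_part (Finset.mem_univ x)
      have h2 : y ∈ π.part x := by rw [hxy]; exact π.mem_part (Finset.mem_univ y)
      rcases hπ _ (π.part_mem.2 (Finset.mem_univ x)) h1 h2 hne with h | h
      · exact hγ hx hy hne h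
      · exact hγ hy hx (Ne.symm hne) h
  obtain ⟨f, hf, hf'⟩ := exists_chain_coloring (Finset.univ : Finset P) β.card
    fun γ _ hγ => hmax γ hγ
  let π : Finpartition (Finset.univ : Finset P) := Finpartition.ofSetoid (Setoid.ker f)
  have hπ : ∀ c ∈ π.parts, IsChain (· ≤ ·) (c : Set P) := by
    intro c hc x hx y hy _
    have hcx : c = π.part x := (π.part_eq_of_mem hc hx).symm
    have : y ∈ π.part x := hcx ▸ hy
    rw [Finpartition.mem_part_ofSetoid_iff_rel] at this
    exact hf' x (Finset.mem_univ x) y (Finset.mem_univ y) this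
  have hπβ : π.parts.card ≤ β.card := by
    rw [← Finset.card_range β.card]
    -- Each part is sent to its colour; parts are nonempty, so the value `0` is never used.
    refine Finset.card_le_card_of_injOn (fun c => if h : c.Nonempty then f h.choose else 0) ?_ ?_
    · intro c hc
      have h := π.nonempty_of_mem_parts hc
      simp only [h, dif_pos]
      exact Finset.mem_coe.2 (Finset.mem_range.2 (hf _ (Finset.mem_univ _)))
    · intro c hc c' hc' heq
      have h := π.nonempty_of_mem_parts hc
      have h' := π.nonempty_of_mem_parts hc'
      simp only [h, h', dif_pos] at heq
      rw [← π.part_eq_of_mem hc h.choose_spec, ← π.part_eq_of_mem hc' h'.choose_spec]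
      refine π.part_eq_of_mem (π.part_mem.2 (Finset.mem_univ _)) ?_
      rw [Finpartition.mem_part_ofSetoid_iff_rel]
      exact heq.symm
  have hD : dilworthNumber P = β.card := by
    apply le_antisymm
    · rw [dilworthNumber]
      exact le_trans (Nat.sInf_le (Set.mem_ofPred.2 ⟨π, hπ, rfl⟩)) hπβ
    · rw [dilworthNumber]
      refine le_csInf (Set.nonempty_of_mem (x := π.parts.card) ⟨π, by convert hπ, rfl⟩) ?_
      rintro _ ⟨ρ, hρ, rfl⟩
      exact hlow β hβ ρ hρ
  rw [hD]
  refine ⟨⟨β, hβ, rfl⟩, ?_⟩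
  rintro _ ⟨γ, hγ, rfl⟩
  exact hmax γ hγ

/-! ### Rank and cardinality of chains -/

/-- In a finite nonempty poset of rank `r`, the largest chains have `r + 1` elements. -/
theorem exists_krullDim_eq_and_isChain_card (P : Type*) [Fintype P] [PartialOrder P] [Nonempty P] :
    ∃ r : ℕ, Order.krullDim P = r ∧
      (∃ α : Finset P, IsChain (· ≤ ·) (α : Set P) ∧ α.card = r + 1) ∧
      ∀ α : Finset P, IsChain (· ≤ ·) (α : Set P) → α.card ≤ r + 1 := by
  classical
  have : FiniteDimensionalOrder P := by
    refine (finiteDimensionalOrder_or_infiniteDimensionalOrder P).resolve_right fun h => ?_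
    have h1 := (LTSeries.withLength P (Fintype.card P)).length_lt_card
    rw [LTSeries.length_withLength] at h1
    exact lt_irrefl _ h1
  refine ⟨_, Order.krullDim_eq_length_of_finiteDimensionalOrder,
    ⟨Finset.univ.image (LTSeries.longestOf P), ?_, ?_⟩, fun α hα => ?_⟩
  · rw [Finset.coe_image, Finset.coe_univ, Set.image_univ]
    exact (LTSeries.longestOf P).strictMono.monotone.isChain_range
  · rw [Finset.card_image_of_injective _ (LTSeries.longestOf P).strictMono.injective]
    simp
  · by_contra! hcard
    -- The chain is listed in increasing order to give a strict series whose length is its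
    -- cardinality minus one.
    let L : LinearOrder α :=
      { (inferInstance : PartialOrder α) with
        le_total := fun x y => hα.total x.2 y.2
        toDecidableLE := Classical.decRel _ }
    obtain ⟨m, hm⟩ := Nat.exists_eq_succ_of_ne_zero (show α.card ≠ 0 by omega)
    have hm' : Fintype.card α = m + 1 := by simpa using hm
    let e : Fin (m + 1) ≃o α := Fintype.orderIsoFinOfCardEq α hm'
    let p : LTSeries P := LTSeries.mk m (fun i => (e i : P))
      fun i j hij => by
        have : e i < e j := e.strictMono hij
        exact this
    have := LTSeries.longestOf_is_longest p
    have h2 : p.length = m := rfl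
    omega

/-! ### The cubical complex of a simplicial complex and its exactness -/

section CubicalComplex

variable {V S : Type*} [CommRing S]

/-- `c` is a chain of degree `i` of the cubical complex of `Δ`. -/
def IsCubicalChain (Δ : Finset (Finset V)) (i : ℕ) (c : Finset V → Finset V → S) : Prop :=
  ∀ F σ, c F σ ≠ 0 → F ∈ Δ ∧ σ ⊆ F ∧ σ.card = i

section

variable [Fintype V]

/-- The augmentation of the cubical complex with values `u F` at the vertices. -/
def cubeAug (u : Finset V → S) : (Finset V → Finset V → S) →ₗ[S] S where
  toFun c := ∑ F, c F ∅ * u F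
  map_add' b c := by simp [add_mul, Finset.sum_add_distrib]
  map_smul' a c := by simp [Finset.mul_sum, mul_assoc]

theorem cubeAug_apply (u : Finset V → S) (c : Finset V → Finset V → S) :
    cubeAug u c = ∑ F, c F ∅ * u F := rfl

end

variable [DecidableEq V]

/-- Drives the inductions on `Δ`: what remains after deleting a maximal face is again a simplicial
complex. -/
theorem IsLowerSet.exists_maximal_face {Δ : Finset (Finset V)}
    (hΔ : IsLowerSet (Δ : Set (Finset V))) (hne : Δ.Nonempty) :
    ∃ F ∈ Δ, (∀ v ∉ F, insert v F ∉ Δ) ∧ (∀ G ∈ Δ, F ⊆ G → G = F) ∧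
      IsLowerSet ((Δ.erase F : Finset (Finset V)) : Set (Finset V)) := by
  obtain ⟨F, hF, hmax⟩ := Δ.exists_maximal hne
  have hmax' : ∀ G ∈ Δ, F ⊆ G → G = F := fun G hG h => (hmax hG h).antisymm h
  refine ⟨F, hF, fun v hv h => hv ?_, hmax', fun G H hHG hG => ?_⟩
  · rw [← hmax' _ h (Finset.subset_insert _ _)]
    exact Finset.mem_insert_self _ _
  · rw [Finset.mem_coe, Finset.mem_erase] at hG ⊢
    refine ⟨?_, hΔ hHG hG.2⟩
    rintro rfl
    exact hG.1 (hmax' G hG.2 hHG)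

variable (x y : V → S)

/-- The face operator in direction `v` of the cubical complex whose cells `(F, σ)`, with `σ ⊆ F`,
are the intervals `[F \ σ, F]` of subsets of `V`. -/
def cubeFace (v : V) (c : Finset V → Finset V → S) (G τ : Finset V) : S :=
  -- For `v ∉ τ`, the cell `(G, τ)` is a face in direction `v` of just one cube: the upper face of
  -- `(G, τ ∪ v)` if `v ∈ G`, the lower face of `(G ∪ v, τ ∪ v)` otherwise.
  if v ∈ G then y v * c G (insert v τ) else -(x v * c (insert v G) (insert v τ))

/-- Face operators in different directions act independently, which leaves the vanishing of the
squared boundary to the signs. -/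
theorem cubeFace_comm {v w : V} (hvw : v ≠ w) (c : Finset V → Finset V → S) (G τ : Finset V) :
    cubeFace x y v (cubeFace x y w c) G τ = cubeFace x y w (cubeFace x y v c) G τ := by
  simp only [cubeFace, Finset.mem_insert, hvw, hvw.symm, false_or, Finset.insert_comm v w]
  split_ifs <;> ring

variable [Fintype V] (idx : V → ℕ)

/-- The differential of the cubical complex of subsets of `V` with coefficients `x v` and `y v`;
a chain is written as the function of its coefficients at the cells. -/
def cubeD : (Finset V → Finset V → S) →ₗ[S] (Finset V → Finset V → S) where
  toFun c G τ := ∑ v, if v ∈ τ then 0 else insertSign idx S v τ * cubeFace x y v c G τ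
  map_add' b c := by
    ext G τ
    simp only [Pi.add_apply, ← Finset.sum_add_distrib]
    refine Finset.sum_congr rfl fun v _ => ?_
    simp only [cubeFace, Pi.add_apply]
    split_ifs <;> ring
  map_smul' a c := by
    ext G τ
    simp only [Pi.smul_apply, smul_eq_mul, RingHom.id_apply, Finset.mul_sum]
    refine Finset.sum_congr rfl fun v _ => ?_
    simp only [cubeFace, Pi.smul_apply, smul_eq_mul]
    split_ifs <;> ring

theorem cubeD_apply (c : Finset V → Finset V → S) (G τ : Finset V) :
    cubeD x y idx c G τ =
      ∑ v, if v ∈ τ then 0 else insertSign idx S v τ * cubeFace x y v c G τ := rfl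

theorem cubeFace_cubeD (v : V) (c : Finset V → Finset V → S) (G τ : Finset V) :
    cubeFace x y v (cubeD x y idx c) G τ = ∑ w, if w ∈ insert v τ then 0 else
      insertSign idx S w (insert v τ) * cubeFace x y v (cubeFace x y w c) G τ := by
  by_cases h : v ∈ G
  · simp only [cubeFace, h, if_true, cubeD_apply, Finset.mul_sum]
    refine Finset.sum_congr rfl fun w _ => ?_
    split_ifs <;> ring
  · simp only [cubeFace, h, if_false, cubeD_apply, Finset.mul_sum, ← Finset.sum_neg_distrib]
    refine Finset.sum_congr rfl fun w _ => ?_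
    split_ifs <;> ring

theorem cubeD_cubeD (hidx : Function.Injective idx) (c : Finset V → Finset V → S) :
    cubeD x y idx (cubeD x y idx c) = 0 := by
  ext G τ
  rw [cubeD_apply]
  simp only [cubeFace_cubeD, Pi.zero_apply]
  have h1 : ∀ v, (if v ∈ τ then (0 : S) else insertSign idx S v τ * ∑ w,
      if w ∈ insert v τ then 0 else
        insertSign idx S w (insert v τ) * cubeFace x y v (cubeFace x y w c) G τ) =
      ∑ w, if v ∈ τ ∨ w ∈ τ ∨ v = w then 0 else
        insertSign idx S v τ * insertSign idx S w (insert v τ) *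
          cubeFace x y v (cubeFace x y w c) G τ := by
    intro v
    by_cases hv : v ∈ τ
    · simp [hv]
    · rw [if_neg hv, Finset.mul_sum]
      refine Finset.sum_congr rfl fun w _ => ?_
      by_cases hw : w ∈ τ
      · simp [hw]
      · by_cases hvw : v = w
        · simp [hvw]
        · simp [hv, hw, hvw, Ne.symm hvw, mul_assoc]
  rw [Finset.sum_congr rfl fun v _ => h1 v, ← Finset.sum_product']
  -- Removing `v` and `w` in either order gives the same face with opposite signs.
  refine Finset.sum_involution (fun p _ => p.swap) ?_ ?_ (by simp) (by simp)
  · rintro ⟨v, w⟩ -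
    simp only [Prod.swap_prod_mk]
    by_cases h : v ∈ τ ∨ w ∈ τ ∨ v = w
    · rw [if_pos h, if_pos (by tauto), add_zero]
    · rw [if_neg h, if_neg (by tauto)]
      push Not at h
      rw [insertSign_antisymm idx hidx h.1 h.2.1 h.2.2, cubeFace_comm x y h.2.2]
      ring
  · rintro ⟨v, w⟩ - h heq
    simp only [Prod.swap_prod_mk, Prod.mk.injEq] at heq
    simp [heq.2] at h

theorem IsCubicalChain.isCubicalChain_cubeD {Δ : Finset (Finset V)} (hΔ : IsLowerSet (Δ : Set (Finset V)))
    {i : ℕ} {c : Finset V → Finset V → S} (hc : IsCubicalChain Δ (i + 1) c) :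
    IsCubicalChain Δ i (cubeD x y idx c) := by
  intro G τ h
  obtain ⟨v, -, hv⟩ := Finset.exists_ne_zero_of_sum_ne_zero h
  by_cases hvτ : v ∈ τ
  · simp [hvτ] at hv
  rw [if_neg hvτ, cubeFace] at hv
  by_cases hvG : v ∈ G
  · rw [if_pos hvG] at hv
    obtain ⟨h1, h2, h3⟩ := hc G (insert v τ) fun h => hv (by simp [h])
    rw [Finset.card_insert_of_notMem hvτ] at h3
    exact ⟨h1, (Finset.subset_insert _ _).trans h2, by omega⟩
  · rw [if_neg hvG] at hv
    obtain ⟨h1, h2, h3⟩ := hc (insert v G) (insert v τ) fun h => hv (by simp [h])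
    rw [Finset.card_insert_of_notMem hvτ] at h3
    refine ⟨hΔ (Finset.subset_insert v G) h1, fun w hw => ?_, by omega⟩
    rcases Finset.mem_insert.1 (h2 (Finset.mem_insert_of_mem hw)) with rfl | h
    · exact absurd hw hvτ
    · exact h

/-- On a maximal face, the differential is that of a Koszul complex. -/
theorem IsCubicalChain.cubeD_apply_maximal {Δ : Finset (Finset V)} {i : ℕ}
    {c : Finset V → Finset V → S} (hc : IsCubicalChain Δ i c) {F : Finset V}
    (hF : ∀ v ∉ F, insert v F ∉ Δ) :
    cubeD x y idx c F = koszulD idx y F (c F) := by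
  ext τ
  rw [cubeD_apply, koszulD_apply, ← Finset.sum_subset (Finset.subset_univ (F \ τ))]
  · refine Finset.sum_congr rfl fun v hv => ?_
    rw [Finset.mem_sdiff] at hv
    rw [if_neg hv.2, cubeFace, if_pos hv.1]
  · intro v _ hv
    by_cases hvτ : v ∈ τ
    · rw [if_pos hvτ]
    · have hvF : v ∉ F := fun h => hv (Finset.mem_sdiff.2 ⟨h, hvτ⟩)
      have : c (insert v F) (insert v τ) = 0 := by_contra fun h => hF v hvF (hc _ _ h).1
      rw [if_neg hvτ, cubeFace, if_neg hvF, this]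
      simp

/-- Induction step for exactness: a cycle that is a Koszul boundary on a maximal face can be
pushed off this face. -/
theorem IsCubicalChain.sub_cubeD_of_koszulD_eq {Δ : Finset (Finset V)}
    (hΔ : IsLowerSet (Δ : Set (Finset V))) {i : ℕ} {c : Finset V → Finset V → S}
    (hc : IsCubicalChain Δ i c) {F : Finset V} (hF : F ∈ Δ) (hFmax : ∀ v ∉ F, insert v F ∉ Δ)
    {b : Finset V → S} (hb : ∀ τ, b τ ≠ 0 → τ ⊆ F ∧ τ.card = i + 1)
    (hbc : koszulD idx y F b = c F) :
    ∃ b' : Finset V → Finset V → S, IsCubicalChain Δ (i + 1) b' ∧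
      IsCubicalChain (Δ.erase F) i (c - cubeD x y idx b') := by
  -- `b` is placed on the cells over `F` alone. Its boundary may spill onto smaller faces, but over
  -- `F` it is the Koszul boundary, which equals `c F`.
  let b' : Finset V → Finset V → S := fun G => if G = F then b else 0
  have hb' : IsCubicalChain Δ (i + 1) b' := by
    intro G τ h
    by_cases hG : G = F
    · subst hG
      simp only [b', if_true] at h
      exact ⟨hF, hb τ h⟩
    · simp [b', hG] at h
  refine ⟨b', hb', fun G τ h => ?_⟩
  have h1 : G ∈ Δ ∧ τ ⊆ G ∧ τ.card = i := by
    by_cases h2 : c G τ = 0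
    · refine (hb'.isCubicalChain_cubeD x y idx hΔ) G τ fun h3 => h ?_
      rw [Pi.sub_apply, Pi.sub_apply, h2, h3, sub_zero]
    · exact hc G τ h2
  refine ⟨Finset.mem_erase.2 ⟨?_, h1.1⟩, h1.2⟩
  rintro rfl
  apply h
  rw [Pi.sub_apply, hb'.cubeD_apply_maximal x y idx hFmax]
  simp [b', hbc]

/-- Over a maximal face a cycle restricts to a Koszul cycle, hence to a Koszul boundary. Subtracting
the boundary of a lift leaves a cycle on a smaller complex, and induction applies. -/
theorem IsCubicalChain.exists_cubeD_eq (hidx : Function.Injective idx)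
    (hy : ∀ (G : Finset V) (w : V), w ∉ G → ∀ a, y w * a ∈ Ideal.span (y '' (G : Set V)) →
      a ∈ Ideal.span (y '' (G : Set V)))
    {Δ : Finset (Finset V)} (hΔ : IsLowerSet (Δ : Set (Finset V))) {i : ℕ}
    {c : Finset V → Finset V → S} (hc : IsCubicalChain Δ (i + 1) c)
    (hc0 : cubeD x y idx c = 0) :
    ∃ b, IsCubicalChain Δ (i + 2) b ∧ cubeD x y idx b = c := by
  induction hn : Δ.card generalizing Δ c with
  | zero =>
    refine ⟨0, fun F σ h => absurd rfl h, ?_⟩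
    rw [map_zero]
    ext F σ
    by_contra h
    have := (hc F σ (Ne.symm h)).1
    simp [Finset.card_eq_zero.1 hn] at this
  | succ n ih =>
    obtain ⟨F, hF, hF1, -, hF2⟩ := hΔ.exists_maximal_face (Finset.card_pos.1 (by omega))
    obtain ⟨b, hb, hbc⟩ := exists_koszulD_eq_of_koszulD_eq_zero idx y hidx hy F i (c F)
      (fun τ h => (hc F τ h).2) (by rw [← hc.cubeD_apply_maximal x y idx hF1, hc0]; rfl)
    obtain ⟨b', hb', hcb⟩ := hc.sub_cubeD_of_koszulD_eq x y idx hΔ hF hF1 hb hbc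
    obtain ⟨b'', hb'', h⟩ := ih hF2 hcb (by rw [map_sub, hc0, cubeD_cubeD x y idx hidx, sub_zero])
      (by rw [Finset.card_erase_of_mem hF, hn]; rfl)
    refine ⟨b'' + b', fun G τ h => ?_, by rw [map_add, h, sub_add_cancel]⟩
    by_cases h1 : b' G τ = 0
    · obtain ⟨h2, h3⟩ := hb'' G τ (by simpa [h1] using h)
      exact ⟨Finset.mem_of_mem_erase h2, h3⟩
    · exact hb' G τ h1

theorem cubeAug_cubeD {u : Finset V → S} (hu : ∀ v G, v ∉ G → y v * u (insert v G) = x v * u G)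
    (c : Finset V → Finset V → S) : cubeAug u (cubeD x y idx c) = 0 := by
  rw [cubeAug_apply]
  simp only [cubeD_apply, Finset.notMem_empty, if_false, insertSign_empty, one_mul, Finset.sum_mul]
  rw [Finset.sum_comm]
  refine Finset.sum_eq_zero fun v _ => ?_
  -- The two ends of each edge in direction `v` cancel, by the relation `hu`.
  refine Finset.sum_involution (fun G _ => if v ∈ G then G.erase v else insert v G) ?_ ?_
    (by simp) ?_
  · intro G _
    by_cases h : v ∈ G
    · have := hu v (G.erase v) (Finset.notMem_erase v G)
      rw [Finset.insert_erase h] at this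
      simp only [cubeFace, h, if_true, Finset.notMem_erase, if_false, Finset.insert_erase]
      linear_combination c G (insert v ∅) * this
    · have := hu v G h
      simp only [cubeFace, h, if_false, Finset.mem_insert_self, if_true]
      linear_combination c (insert v G) (insert v ∅) * this
  · intro G _ _ heq
    by_cases h : v ∈ G
    · rw [if_pos h] at heq
      have h1 := Finset.notMem_erase v G
      rw [heq] at h1
      exact h1 h
    · rw [if_neg h] at heq
      exact h (heq ▸ Finset.mem_insert_self v G)
  · intro G _
    by_cases h : v ∈ G
    · simp [h]
    · simp [h]

/-- In a relation among the `u G`, all terms other than the one at a maximal face `F` lie in `(y_v :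
v ∈ F)`, by `hmem`. By `hreg` the coefficient at `F` lies there too, so it is a Koszul boundary and
can be removed. -/
theorem IsCubicalChain.exists_cubeD_eq_of_cubeAug_eq_zero {u : Finset V → S}
    (hu : ∀ v G, v ∉ G → y v * u (insert v G) = x v * u G)
    (hmem : ∀ F G : Finset V, ¬ F ⊆ G → u G ∈ Ideal.span (y '' (F : Set V)))
    (hreg : ∀ (F : Finset V) a, u F * a ∈ Ideal.span (y '' (F : Set V)) → a ∈ Ideal.span (y '' (F : Set V)))
    {Δ : Finset (Finset V)} (hΔ : IsLowerSet (Δ : Set (Finset V)))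
    {c : Finset V → Finset V → S} (hc : IsCubicalChain Δ 0 c) (hc0 : cubeAug u c = 0) :
    ∃ b, IsCubicalChain Δ 1 b ∧ cubeD x y idx b = c := by
  induction hn : Δ.card generalizing Δ c with
  | zero =>
    refine ⟨0, fun F σ h => absurd rfl h, ?_⟩
    rw [map_zero]
    ext F σ
    by_contra h
    have := (hc F σ (Ne.symm h)).1
    simp [Finset.card_eq_zero.1 hn] at this
  | succ n ih =>
    obtain ⟨F, hF, hF1, hF3, hF2⟩ := hΔ.exists_maximal_face (Finset.card_pos.1 (by omega))
    have hspan : c F ∅ ∈ Ideal.span (y '' (F : Set V)) := by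
      apply hreg
      have h1 : u F * c F ∅ = -∑ G ∈ Finset.univ.erase F, c G ∅ * u G := by
        rw [cubeAug_apply, ← Finset.add_sum_erase _ _ (Finset.mem_univ F)] at hc0
        linear_combination hc0
      rw [h1]
      refine neg_mem (Ideal.sum_mem _ fun G hG => ?_)
      by_cases h2 : c G ∅ = 0
      · simp [h2]
      · refine Ideal.mul_mem_left _ _ (hmem F G fun h3 => ?_)
        exact Finset.ne_of_mem_erase hG (hF3 G (hc G ∅ h2).1 h3)
    obtain ⟨b, hb, hbc⟩ := exists_koszulD_eq_of_mem_span idx y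
      (fun τ h => Finset.card_eq_zero.1 (hc F τ h).2.2) hspan
    obtain ⟨b', hb', hcb⟩ := hc.sub_cubeD_of_koszulD_eq x y idx hΔ hF hF1 hb hbc
    obtain ⟨b'', hb'', h⟩ := ih hF2 hcb
      (by rw [map_sub, hc0, cubeAug_cubeD x y idx hu, sub_zero])
      (by rw [Finset.card_erase_of_mem hF, hn]; rfl)
    refine ⟨b'' + b', fun G τ h => ?_, by rw [map_add, h, sub_add_cancel]⟩
    by_cases h1 : b' G τ = 0
    · obtain ⟨h2, h3⟩ := hb'' G τ (by simpa [h1] using h)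
      exact ⟨Finset.mem_of_mem_erase h2, h3⟩
    · exact hb' G τ h1

end CubicalComplex

open MvPolynomial

/-! ### The monomials `u_F` and ideals generated by variables -/

section FaceIdeal

variable {K V : Type*} [Field K]

/-- Membership in an ideal of variables is tested on the exponents at `s` of each monomial, and
multiplication by `X i` changes only the exponent at `i`. -/
theorem mem_span_X_image_of_X_mul_mem {σ : Type*} {s : Set σ} {i : σ} (hi : i ∉ s)
    {a : MvPolynomial σ K} (h : X i * a ∈ Ideal.span (X '' s : Set (MvPolynomial σ K))) :
    a ∈ Ideal.span (X '' s : Set (MvPolynomial σ K)) := by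
  classical
  rw [mem_ideal_span_X_image] at h ⊢
  intro m hm
  obtain ⟨j, hj, hne⟩ := h (Finsupp.single i 1 + m) (by
    rw [mem_support_iff, coeff_X_mul]
    exact mem_support_iff.1 hm)
  refine ⟨j, hj, ?_⟩
  have : i ≠ j := fun h => hi (h ▸ hj)
  simpa [Finsupp.single_apply, this] using hne

theorem mem_span_X_image_of_prod_mul_mem {σ ι : Type*} {s : Set σ} (t : Finset ι) {f : ι → σ}
    (hf : ∀ i ∈ t, f i ∉ s) {a : MvPolynomial σ K}
    (h : (∏ i ∈ t, X (f i)) * a ∈ Ideal.span (X '' s : Set (MvPolynomial σ K))) :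
    a ∈ Ideal.span (X '' s : Set (MvPolynomial σ K)) := by
  classical
  induction t using Finset.induction_on with
  | empty => simpa using h
  | insert i t hi ih =>
    rw [Finset.prod_insert hi, mul_assoc] at h
    exact ih (fun j hj => hf j (Finset.mem_insert_of_mem hj))
      (mem_span_X_image_of_X_mul_mem (hf i (Finset.mem_insert_self i t)) h)

variable [Fintype V]

theorem posetMonomial_eq [DecidableEq V] (F : Finset V) :
    posetMonomial K F = (∏ p ∈ F, X (Sum.inl p)) * ∏ p ∈ Fᶜ, X (Sum.inr p) := by
  unfold posetMonomial
  congr!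

theorem posetMonomial_ne_zero (F : Finset V) : posetMonomial K F ≠ 0 :=
  mul_ne_zero (Finset.prod_ne_zero_iff.2 fun _ _ => X_ne_zero _)
    (Finset.prod_ne_zero_iff.2 fun _ _ => X_ne_zero _)

theorem posetMonomial_isHomogeneous (F : Finset V) :
    (posetMonomial K F).IsHomogeneous (Fintype.card V) := by
  classical
  rw [posetMonomial_eq, ← Finset.card_add_card_compl F]
  refine IsHomogeneous.mul ?_ ?_
  · simpa using IsHomogeneous.prod F (fun p => (X (Sum.inl p) : MvPolynomial (V ⊕ V) K))
      (fun _ => 1) fun p _ => isHomogeneous_X K _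
  · simpa using IsHomogeneous.prod Fᶜ (fun p => (X (Sum.inr p) : MvPolynomial (V ⊕ V) K))
      (fun _ => 1) fun p _ => isHomogeneous_X K _

theorem X_inr_mul_posetMonomial_insert [DecidableEq V] {v : V} {G : Finset V} (hv : v ∉ G) :
    X (Sum.inr v) * posetMonomial K (insert v G) = X (Sum.inl v) * posetMonomial K G := by
  rw [posetMonomial_eq, posetMonomial_eq, Finset.prod_insert hv,
    ← Finset.mul_prod_erase Gᶜ _ (Finset.mem_compl.2 hv), Finset.compl_insert]
  ring

theorem posetMonomial_mem_span {F G : Finset V} (h : ¬ F ⊆ G) :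
    posetMonomial K G ∈ Ideal.span ((fun v => (X (Sum.inr v) : MvPolynomial (V ⊕ V) K)) ''
      (F : Set V)) := by
  classical
  obtain ⟨v, hv, hvG⟩ := Finset.not_subset.1 h
  rw [posetMonomial_eq, ← Finset.mul_prod_erase Gᶜ _ (Finset.mem_compl.2 hvG)]
  exact Ideal.mul_mem_left _ _ (Ideal.mul_mem_right _ _ (Ideal.subset_span ⟨v, hv, rfl⟩))

/-- The variables dividing `u_F` are the `x_p` with `p ∈ F` and the `y_p` with `p ∉ F`; none is a
`y_v` with `v ∈ F`. -/
theorem mem_span_of_posetMonomial_mul_mem {F : Finset V} {a : MvPolynomial (V ⊕ V) K}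
    (h : posetMonomial K F * a ∈ Ideal.span
      ((fun v => (X (Sum.inr v) : MvPolynomial (V ⊕ V) K)) '' (F : Set V))) :
    a ∈ Ideal.span ((fun v => (X (Sum.inr v) : MvPolynomial (V ⊕ V) K)) '' (F : Set V)) := by
  classical
  rw [← Set.image_image X Sum.inr] at h ⊢
  rw [posetMonomial_eq, mul_assoc] at h
  exact mem_span_X_image_of_prod_mul_mem Fᶜ (by simp)
    (mem_span_X_image_of_prod_mul_mem F (by simp) h)

end FaceIdeal

/-! ### The cubical resolution as a graded free resolution -/

section Resolution

/-- A graded free resolution assembled from modules indexed by arbitrary finite types. -/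
noncomputable def GradedFreeResolution.ofFintype {σ K : Type*} [Field K]
    {I : Ideal (MvPolynomial σ K)} {ι : ℕ → Type*} [∀ i, Fintype (ι i)]
    [∀ i, DecidableEq (ι i)] (shift : (i : ℕ) → ι i → ℕ)
    (aug : (ι 0 → MvPolynomial σ K) →ₗ[MvPolynomial σ K] MvPolynomial σ K)
    (d : (i : ℕ) → (ι (i + 1) → MvPolynomial σ K) →ₗ[MvPolynomial σ K] (ι i → MvPolynomial σ K))
    (aug_homogeneous : ∀ j, (aug (Pi.single j 1)).IsHomogeneous (shift 0 j))
    (d_homogeneous : ∀ i j, IsHomogeneousVector (shift i) (d i (Pi.single j 1)) (shift (i + 1) j))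
    (range_aug : LinearMap.range aug = I)
    (exact_zero : LinearMap.range (d 0) = LinearMap.ker aug)
    (exact_succ : ∀ i, LinearMap.range (d (i + 1)) = LinearMap.ker (d i)) :
    GradedFreeResolution I :=
  let e : (i : ℕ) → (Fin (Fintype.card (ι i)) → MvPolynomial σ K) ≃ₗ[MvPolynomial σ K]
      (ι i → MvPolynomial σ K) := fun i =>
    LinearEquiv.funCongrLeft _ _ (Fintype.equivFin (ι i))
  have he : ∀ i j, e i (Pi.single j 1) = Pi.single ((Fintype.equivFin (ι i)).symm j) 1 := by
    intro i j
    ext1 k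
    simp [e, LinearEquiv.funCongrLeft_apply, LinearMap.funLeft_apply, Pi.single_apply,
      Equiv.eq_symm_apply]
  { rank := fun i => Fintype.card (ι i)
    shift := fun i j => shift i ((Fintype.equivFin (ι i)).symm j)
    aug := aug ∘ₗ (e 0).toLinearMap
    d := fun i => (e i).symm.toLinearMap ∘ₗ d i ∘ₗ (e (i + 1)).toLinearMap
    aug_homogeneous := fun j => by
      simp only [LinearMap.comp_apply, LinearEquiv.coe_coe, he]
      exact aug_homogeneous _
    d_homogeneous := fun i j k => by
      simp only [LinearMap.comp_apply, LinearEquiv.coe_coe, he]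
      exact d_homogeneous i _ _
    range_aug := by rw [LinearEquiv.range_comp, range_aug]
    exact_zero := by
      rw [LinearMap.range_comp, LinearEquiv.range_comp, exact_zero, LinearMap.ker_comp]
      exact Submodule.map_equiv_eq_comap_symm _ _
    exact_succ := fun i => by
      rw [LinearMap.range_comp, LinearEquiv.range_comp, exact_succ, LinearEquiv.ker_comp,
        LinearMap.ker_comp]
      exact Submodule.map_equiv_eq_comap_symm _ _ }

variable {V : Type*} [DecidableEq V] (Δ : Finset (Finset V))

/-- The cells of dimension `i` of the cubical complex of `Δ`. -/
abbrev CubicalCell (i : ℕ) : Type _ :=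
  {p : Finset V × Finset V // p.1 ∈ Δ ∧ p.2 ⊆ p.1 ∧ p.2.card = i}

/-- Extension by zero of a function on the cells. -/
def cellExtend (S : Type*) [CommRing S] (i : ℕ) :
    (CubicalCell Δ i → S) →ₗ[S] (Finset V → Finset V → S) where
  toFun c F σ := if h : F ∈ Δ ∧ σ ⊆ F ∧ σ.card = i then c ⟨(F, σ), h⟩ else 0
  map_add' b c := by
    ext F σ
    simp only [Pi.add_apply]
    split_ifs <;> simp
  map_smul' a c := by
    ext F σ
    simp only [Pi.smul_apply, RingHom.id_apply]
    split_ifs <;> simp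

/-- Restriction to the cells. -/
def cellRestrict (S : Type*) [CommRing S] (i : ℕ) :
    (Finset V → Finset V → S) →ₗ[S] (CubicalCell Δ i → S) where
  toFun c p := c p.1.1 p.1.2
  map_add' _ _ := rfl
  map_smul' _ _ := rfl

variable {Δ} {S : Type*} [CommRing S]

theorem isCubicalChain_cellExtend {i : ℕ} (c : CubicalCell Δ i → S) :
    IsCubicalChain Δ i (cellExtend Δ S i c) := by
  intro F σ h
  by_contra h'
  exact h (dif_neg h')

theorem IsCubicalChain.cellExtend_cellRestrict {i : ℕ} {c : Finset V → Finset V → S}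
    (hc : IsCubicalChain Δ i c) : cellExtend Δ S i (cellRestrict Δ S i c) = c := by
  ext F σ
  by_cases h : F ∈ Δ ∧ σ ⊆ F ∧ σ.card = i
  · exact dif_pos h
  · exact (dif_neg h).trans (not_not.1 fun h' => h (hc F σ (Ne.symm h')))

theorem cellRestrict_cellExtend {i : ℕ} (c : CubicalCell Δ i → S) :
    cellRestrict Δ S i (cellExtend Δ S i c) = c := by
  ext ⟨⟨F, σ⟩, h⟩
  exact dif_pos h

theorem cellExtend_single {i : ℕ} (p : CubicalCell Δ i) (F σ : Finset V) :
    cellExtend Δ S i (Pi.single p 1) F σ = if (F, σ) = p.1 then 1 else 0 := by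
  by_cases h : F ∈ Δ ∧ σ ⊆ F ∧ σ.card = i
  · refine (dif_pos h).trans ?_
    rw [Pi.single_apply]
    simp [Subtype.ext_iff]
  · refine (dif_neg h).trans (if_neg fun h' => h ?_).symm
    have := p.2
    rw [← h'] at this
    exact this

variable {K : Type*} [Field K] [Fintype V] (idx : V → ℕ)

/-- Matrix entries are sums of signed variables, the signs being constants. This gives the grading
of the resolution. -/
theorem cubeD_single_isHomogeneous {i : ℕ} (p : CubicalCell Δ i) (G τ : Finset V) :
    (cubeD (fun v => (X (Sum.inl v) : MvPolynomial (V ⊕ V) K)) (fun v => X (Sum.inr v)) idx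
      (cellExtend Δ _ i (Pi.single p 1)) G τ).IsHomogeneous 1 := by
  have hs : ∀ v, (insertSign idx (MvPolynomial (V ⊕ V) K) v τ).IsHomogeneous 0 := by
    intro v
    have : insertSign idx (MvPolynomial (V ⊕ V) K) v τ =
        C ((-1) ^ (τ.filter fun w => idx w < idx v).card) := by simp [insertSign]
    rw [this]
    exact isHomogeneous_C _ _
  have hX : ∀ (j : V ⊕ V) (q : Prop) [Decidable q],
      (X j * (if q then 1 else 0) : MvPolynomial (V ⊕ V) K).IsHomogeneous 1 := by
    intro j q _
    by_cases hq : q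
    · simpa [hq] using isHomogeneous_X K j
    · simpa [hq] using isHomogeneous_zero _ _ 1
  rw [cubeD_apply]
  refine IsHomogeneous.sum _ _ _ fun v _ => ?_
  by_cases hv : v ∈ τ
  · simpa [hv] using isHomogeneous_zero _ _ 1
  · rw [if_neg hv]
    refine (zero_add 1 : 0 + 1 = 1) ▸ IsHomogeneous.mul (n := 1) (hs v) ?_
    by_cases hG : v ∈ G
    · rw [cubeFace, if_pos hG, cellExtend_single]
      exact hX _ _
    · rw [cubeFace, if_neg hG, cellExtend_single]
      exact (hX _ _).neg

/-- The cubical resolution of the face ideal of a simplicial complex. -/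
noncomputable def cubicalResolution (hidx : Function.Injective idx)
    (hΔ : IsLowerSet (Δ : Set (Finset V))) {I : Ideal (MvPolynomial (V ⊕ V) K)}
    (hI : I = Ideal.span (posetMonomial K '' (Δ : Set (Finset V)))) :
    GradedFreeResolution I :=
  let x : V → MvPolynomial (V ⊕ V) K := fun v => X (Sum.inl v)
  let y : V → MvPolynomial (V ⊕ V) K := fun v => X (Sum.inr v)
  have hu : ∀ v G, v ∉ G → y v * posetMonomial K (insert v G) = x v * posetMonomial K G :=
    fun v G hv => X_inr_mul_posetMonomial_insert hv
  -- Boundaries of chains on `Δ` stay on `Δ`, because `Δ` is closed under subsets; restricting to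
  -- cells therefore loses nothing.
  have ext_d : ∀ i (c : CubicalCell Δ (i + 1) → MvPolynomial (V ⊕ V) K),
      cellExtend Δ _ i (cellRestrict Δ _ i (cubeD x y idx (cellExtend Δ _ (i + 1) c))) =
        cubeD x y idx (cellExtend Δ _ (i + 1) c) := fun i c =>
    ((isCubicalChain_cellExtend c).isCubicalChain_cubeD x y idx hΔ).cellExtend_cellRestrict
  GradedFreeResolution.ofFintype (ι := CubicalCell Δ) (fun i _ => Fintype.card V + i)
    (cubeAug (posetMonomial K) ∘ₗ cellExtend Δ _ 0)
    (fun i => cellRestrict Δ _ i ∘ₗ cubeD x y idx ∘ₗ cellExtend Δ _ (i + 1))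
    (by
      intro p
      simp only [LinearMap.comp_apply, cubeAug_apply, cellExtend_single, add_zero]
      refine IsHomogeneous.sum _ _ _ fun F _ => ?_
      by_cases h : (F, ∅) = p.1
      · simpa [h] using posetMonomial_isHomogeneous F
      · simpa [h] using isHomogeneous_zero _ _ _)
    (by
      intro i p q m hm
      have h := cubeD_single_isHomogeneous (K := K) idx p q.1.1 q.1.2 (mem_support_iff.1 hm)
      have h' : m.degree = 1 := (DFunLike.congr_fun Finsupp.degree_eq_weight_one m).trans h
      rw [h']
      ring)
    (by
      rw [hI]
      apply le_antisymm
      · rintro _ ⟨c, rfl⟩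
        refine Ideal.sum_mem _ fun F _ => ?_
        by_cases h : cellExtend Δ (MvPolynomial (V ⊕ V) K) 0 c F ∅ = 0
        · rw [h, zero_mul]
          exact zero_mem _
        · exact Ideal.mul_mem_left _ _
            (Ideal.subset_span ⟨F, (isCubicalChain_cellExtend c F ∅ h).1, rfl⟩)
      · rw [Ideal.span_le]
        rintro _ ⟨F, hF, rfl⟩
        refine ⟨Pi.single ⟨(F, ∅), hF, by simp⟩ 1, ?_⟩
        simp [LinearMap.comp_apply, cubeAug_apply, cellExtend_single])
    (by
      ext c
      simp only [LinearMap.mem_range, LinearMap.mem_ker, LinearMap.comp_apply]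
      constructor
      · rintro ⟨b, rfl⟩
        rw [ext_d, cubeAug_cubeD x y idx hu]
      · intro h
        obtain ⟨b, hb, hbc⟩ := (isCubicalChain_cellExtend c).exists_cubeD_eq_of_cubeAug_eq_zero
          x y idx hu (fun F G h => posetMonomial_mem_span h)
          (fun F a h => mem_span_of_posetMonomial_mul_mem h) hΔ h
        refine ⟨cellRestrict Δ _ 1 b, ?_⟩
        rw [hb.cellExtend_cellRestrict, hbc, cellRestrict_cellExtend])
    (by
      intro i
      ext c
      simp only [LinearMap.mem_range, LinearMap.mem_ker, LinearMap.comp_apply]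
      constructor
      · rintro ⟨b, rfl⟩
        rw [ext_d, cubeD_cubeD x y idx hidx, map_zero]
      · intro h
        obtain ⟨b, hb, hbc⟩ := (isCubicalChain_cellExtend c).exists_cubeD_eq x y idx hidx
          (fun G w hw a h => by
            have h' : (y '' (G : Set V)) = X '' (Sum.inr '' (G : Set V)) :=
              (Set.image_image X Sum.inr _).symm
            rw [h'] at h ⊢
            exact mem_span_X_image_of_X_mul_mem (by simpa using hw) h) hΔ
          (by rw [← ext_d, h, map_zero])
        refine ⟨cellRestrict Δ _ (i + 2) b, ?_⟩
        rw [hb.cellExtend_cellRestrict, hbc, cellRestrict_cellExtend])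

/-- Generators in consecutive homological degrees differ by one in degree, so a nonzero constant
entry would violate homogeneity. -/
theorem GradedFreeResolution.isMinimal_of_shift_eq {σ K : Type*} [Field K]
    {I : Ideal (MvPolynomial σ K)} (F : GradedFreeResolution I) {d : ℕ}
    (hF : ∀ i j, F.shift i j = d + i) : F.IsMinimal := by
  intro i j k
  by_contra h
  have h1 := F.d_homogeneous i j k 0 (by rwa [mem_support_iff])
  rw [hF, hF, map_zero] at h1
  omega

/-- The face ideal of a simplicial complex has a linear resolution, and its projective dimension
is the largest cardinality of a face. -/
theorem hasLinearResolution_and_projDim_of_faceIdeal {V : Type*} [Fintype V]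
    {I : Ideal (MvPolynomial (V ⊕ V) K)} {p : Finset V → Prop}
    (hI : I = Ideal.span {f | ∃ α, p α ∧ f = posetMonomial K α})
    (hp : ∀ ⦃α β⦄, α ⊆ β → p β → p α) {D : ℕ} (hD : ∃ α, p α ∧ α.card = D)
    (hmax : ∀ α, p α → α.card ≤ D) : HasLinearResolution I ∧ I.projDim = D := by
  classical
  let Δ : Finset (Finset V) := Finset.univ.filter p
  have hmem : ∀ {α}, α ∈ Δ ↔ p α := by simp [Δ]
  have hΔ : IsLowerSet (Δ : Set (Finset V)) := fun β α h hβ => hmem.2 (hp h (hmem.1 hβ))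
  have hI' : I = Ideal.span (posetMonomial K '' (Δ : Set (Finset V))) := by
    rw [hI]
    congr 1
    ext f
    simp [Δ, eq_comm]
  let idx : V → ℕ := fun v => Fintype.equivFin V v
  have hidx : Function.Injective idx := Fin.val_injective.comp (Fintype.equivFin V).injective
  let F : GradedFreeResolution I := cubicalResolution idx hidx hΔ hI'
  have hshift : ∀ i j, F.shift i j = Fintype.card V + i := fun i j => rfl
  have hF : F.IsMinimal := F.isMinimal_of_shift_eq hshift
  obtain ⟨α, hα, hαD⟩ := hD
  refine ⟨⟨_, F, hF, hshift⟩, hF.projDim_eq ?_ ?_ ?_⟩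
  · have : Nonempty (CubicalCell Δ D) := ⟨⟨(α, α), hmem.2 hα, subset_rfl, hαD⟩⟩
    exact Fintype.card_ne_zero (α := CubicalCell Δ D)
  · refine Fintype.card_eq_zero_iff.2 ⟨fun q => ?_⟩
    have h1 := hmax _ (hmem.1 q.2.1)
    have h2 := Finset.card_le_card q.2.2.1
    have h3 := q.2.2.2
    omega
  · intro h
    have h1 : posetMonomial K α ∈ I := by
      rw [hI]
      exact Ideal.subset_span ⟨α, hα, rfl⟩
    rw [h] at h1
    exact posetMonomial_ne_zero α h1

end Resolution

/-! ### Application to chains and antichains -/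

theorem corollary3p2 (K : Type*) [Field K] (P : Type*) [Fintype P] [PartialOrder P] :
    HasLinearResolution (chainIdeal K P) ∧
    HasLinearResolution (antichainIdeal K P) ∧
    (Nonempty P → (chainIdeal K P).projDim = Order.krullDim P + 1) ∧
    (antichainIdeal K P).projDim = dilworthNumber P ∧
    IsGreatest {k : ℕ | ∃ β : Finset P, IsAntichain (· ≤ ·) (β : Set P) ∧ β.card = k}
      (dilworthNumber P) := by
  have hchain : ∀ {D : ℕ}, (∃ α : Finset P, IsChain (· ≤ ·) (α : Set P) ∧ α.card = D) →
      (∀ α : Finset P, IsChain (· ≤ ·) (α : Set P) → α.card ≤ D) →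
      HasLinearResolution (chainIdeal K P) ∧ (chainIdeal K P).projDim = D := fun h h' =>
    hasLinearResolution_and_projDim_of_faceIdeal rfl
      (fun α β hαβ hβ => hβ.mono (Finset.coe_subset.2 hαβ)) h h'
  have hdil := isGreatest_dilworthNumber P
  have hanti : HasLinearResolution (antichainIdeal K P) ∧
      (antichainIdeal K P).projDim = dilworthNumber P :=
    hasLinearResolution_and_projDim_of_faceIdeal rfl
      (fun α β hαβ hβ => hβ.subset (Finset.coe_subset.2 hαβ)) hdil.1
      fun α hα => hdil.2 ⟨α, hα, rfl⟩
  refine ⟨?_, hanti.1, fun hP => ?_, hanti.2, hdil⟩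
  -- Linearity is also claimed for empty `P`, where the rank is not a natural number; there the
  -- empty chain is the only face.
  · obtain hP | hP := isEmpty_or_nonempty P
    · exact (hchain (D := 0) ⟨∅, by simp⟩ fun α _ => by simp [Finset.eq_empty_of_isEmpty α]).1
    · obtain ⟨r, -, h, h'⟩ := exists_krullDim_eq_and_isChain_card P
      exact (hchain h h').1
  · obtain ⟨r, hr, h, h'⟩ := exists_krullDim_eq_and_isChain_card P
    rw [(hchain h h').2, hr]
    norm_cast
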